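/- Let $R\in\mathbb{Z}[x]$ be monic of odd degree. Then almost all quadratic polynomials $Q\in\mathbb{Z}[x]$ share a common root with $R$ in $\overline{\mathbb{F}}_p$ for some prime $p$. Precisely, for real $B\geq 1$ let $\mathcal{Q}(B)$ be the finite set of polynomials $Q=ax^2+bx+c$ with $a,b,c\in\mathbb{Z}$, $a\neq 0$ and $\max(|a|,|b|,|c|)\le B$. Then $$\lim_{B\to\infty}\frac{\#\{Q\in\mathcal{Q}(B) : \text{there are a prime } p \text{ and } x\in\overline{\mathbb{F}}_p \text{ with } R(x)=Q(x)=0 \text{ in } \overline{\mathbb{F}}_p\}}{\#\mathcal{Q}(B)}=1.$$ -/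

import Mathlib

open Polynomial

/-- The quadratic integer polynomials `a x ^ 2 + b x + c` (with `a ≠ 0`) of height at most `B`,
the height being the maximum of the absolute values of the coefficients. -/
def quadraticsUpTo (B : ℝ) : Set ℤ[X] := {Q | Q.natDegree = 2 ∧ Q.supNorm ≤ B}

theorem finite_quadraticsUpTo (B : ℝ) : (quadraticsUpTo B).Finite := by
  let f : ℤ × ℤ × ℤ → ℤ[X] := fun t => C t.1 * X ^ 2 + C t.2.1 * X + C t.2.2
  let I : Set ℤ := Metric.closedBall 0 B
  have hI : I.Finite := (isCompact_closedBall (0 : ℤ) B).finite_of_discrete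
  refine ((hI.prod (hI.prod hI)).image f).subset ?_
  rintro Q ⟨hdeg, hB⟩
  have h (i : ℕ) : Q.coeff i ∈ I := by
    simpa [I] using (Q.le_supNorm i).trans hB
  exact ⟨(Q.coeff 2, Q.coeff 1, Q.coeff 0), ⟨h 2, h 1, h 0⟩,
    (eq_quadratic_of_degree_le_two (natDegree_le_iff_degree_le.mp hdeg.le)).symm⟩

/-- A property holds for almost all quadratic integer polynomials: the proportion of those of
height at most `B` that have the property tends to `1` as `B → ∞`. All sets counted are finite. -/
def ForAlmostAllQuadratics (P : ℤ[X] → Prop) : Prop :=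
  Filter.Tendsto
    (fun B : ℝ => ({Q ∈ quadraticsUpTo B | P Q}.ncard : ℝ) / ((quadraticsUpTo B).ncard : ℝ))
    Filter.atTop (nhds 1)

/-- `R` and `Q` have a common root in an algebraic closure of the field with `p` elements. -/
def ShareRootMod (p : ℕ) [Fact p.Prime] (R Q : ℤ[X]) : Prop :=
  ∃ x : AlgebraicClosure (ZMod p), aeval x R = 0 ∧ aeval x Q = 0

/-! Let `M` be the matrix of multiplication by the root of `R` on ℤ[x]/(R), of size n = deg R. If
det Q(M) ≠ ±1, some prime p divides it, so Q(M) is singular mod p; by spectral mapping an eigenvalue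
of `M` over the algebraic closure of F_p is a root of Q, and R(M) = 0 makes it a root of R
(`shareRootMod_of_dvd_det`). With a, b fixed, det Q(M) is a monic polynomial of degree n in c, so it
equals ±1 for at most 2n values of c (`card_filter_divX_eq_le`). As c has more than B choices, the
exceptions have proportion at most 2n/B. -/

/-- A monic integer polynomial of positive degree annihilates a nonempty square integer matrix. -/
theorem exists_matrix_aeval_eq_zero {R : ℤ[X]} (hR : R.Monic) (hdeg : 0 < R.natDegree) :
    ∃ (n : ℕ) (M : Matrix (Fin n) (Fin n) ℤ), 0 < n ∧ aeval M R = 0 := by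
  let b := (AdjoinRoot.powerBasis' hR).basis
  refine ⟨_, Algebra.leftMulMatrix b (AdjoinRoot.root R), ?_, ?_⟩
  · simpa using hdeg
  · rw [aeval_algHom_apply, AdjoinRoot.aeval_eq, AdjoinRoot.mk_self, map_zero]

/-- If `R` annihilates an integer matrix `M` and `p` divides `det (Q M)`, then `R` and `Q` have
a common root in an algebraic closure of the field with `p` elements. -/
theorem shareRootMod_of_dvd_det {n : ℕ} {M : Matrix (Fin n) (Fin n) ℤ} {R Q : ℤ[X]}
    (hR : aeval M R = 0) (p : ℕ) [Fact p.Prime] (hdvd : (p : ℤ) ∣ (aeval M Q).det) :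
    ShareRootMod p R Q := by
  let F := AlgebraicClosure (ZMod p)
  have : CharP F p := charP_of_injective_algebraMap (algebraMap (ZMod p) F).injective p
  let φ : Matrix (Fin n) (Fin n) ℤ →ₐ[ℤ] Matrix (Fin n) (Fin n) F :=
    (Algebra.ofId ℤ F).mapMatrix
  have hφ (P : ℤ[X]) : aeval (φ M) (P.map (algebraMap ℤ F)) = φ (aeval M P) := by
    rw [aeval_map_algebraMap, aeval_algHom_apply]
  have hdet : (φ (aeval M Q)).det = 0 := by
    have h : (φ (aeval M Q)).det = algebraMap ℤ F (aeval M Q).det :=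
      ((algebraMap ℤ F).map_det _).symm
    rw [h, eq_intCast]
    exact (CharP.intCast_eq_zero_iff F p _).mpr hdvd
  -- An empty matrix has determinant 1, against `hdet`.
  have hpos : Nonempty (Fin n) := by
    by_contra h
    have : IsEmpty (Fin n) := not_nonempty_iff.mp h
    simp at hdet
  have hmem : (0 : F) ∈ spectrum F (aeval (φ M) (Q.map (algebraMap ℤ F))) := by
    rw [spectrum.zero_mem_iff, hφ, Matrix.isUnit_iff_isUnit_det, hdet]
    exact not_isUnit_zero
  rw [spectrum.map_polynomial_aeval_of_nonempty _ _
    (spectrum.nonempty_of_isAlgClosed_of_finiteDimensional F _)] at hmem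
  obtain ⟨x, hx, hQx⟩ := hmem
  refine ⟨x, ?_, by simpa [aeval_def, eval_map] using hQx⟩
  have hRx := spectrum.subset_polynomial_aeval (φ M) (R.map (algebraMap ℤ F)) ⟨x, hx, rfl⟩
  rw [hφ, hR, map_zero, spectrum.zero_eq] at hRx
  simpa [aeval_def, eval_map] using hRx

/-- For a nonempty matrix `M`, among the polynomials `Q` with a given nonconstant part, at most
`2 n` have `det (Q M) = ±1`. -/
theorem card_filter_divX_eq_le {n : ℕ} (hn : 0 < n) (M : Matrix (Fin n) (Fin n) ℤ) (D : ℤ[X])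
    {s : Finset ℤ[X]} (hdet : ∀ Q ∈ s, IsUnit (aeval M Q).det) (hD : ∀ Q ∈ s, Q.divX = D) :
    s.card ≤ 2 * n := by
  classical
  -- Since Q = X * D + c, the minus sign gives χ(c) = det(c + M D(M)) = det Q(M).
  let χ : ℤ[X] := (-(aeval M (X * D))).charpoly
  have hχ : χ.natDegree = n := by simp [χ, Matrix.charpoly_natDegree_eq_dim]
  have hne (u : ℤ) : χ - C u ≠ 0 := by
    intro h
    have := congrArg natDegree (sub_eq_zero.mp h)
    rw [hχ, natDegree_C] at this
    omega
  have hcard (u : ℤ) : (χ - C u).roots.toFinset.card ≤ n :=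
    (Multiset.toFinset_card_le _).trans ((card_roots' _).trans (by rw [natDegree_sub_C, hχ]))
  have hmaps : ∀ Q ∈ s, Q.coeff 0 ∈
      (χ - C 1).roots.toFinset ∪ (χ - C (-1)).roots.toFinset := by
    intro Q hQ
    have heval : χ.eval (Q.coeff 0) = (aeval M Q).det := by
      rw [Matrix.eval_charpoly, sub_neg_eq_add, add_comm]
      conv_rhs => rw [← X_mul_divX_add Q, hD Q hQ, map_add, aeval_C]
      rfl
    rw [Finset.mem_union, Multiset.mem_toFinset, Multiset.mem_toFinset, mem_roots (hne _),
      mem_roots (hne _), IsRoot.def, IsRoot.def, eval_sub, eval_sub, eval_C, eval_C, heval,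
      sub_eq_zero, sub_eq_zero]
    exact Int.isUnit_iff.mp (hdet Q hQ)
  have hinj : Set.InjOn (fun Q : ℤ[X] => Q.coeff 0) s := by
    intro P hP Q hQ h
    rw [← X_mul_divX_add P, ← X_mul_divX_add Q, hD P hP, hD Q hQ]
    exact congrArg _ (congrArg C h)
  calc s.card ≤ _ := Finset.card_le_card_of_injOn _ hmaps hinj
    _ ≤ _ := Finset.card_union_le _ _
    _ ≤ 2 * n := by linarith [hcard 1, hcard (-1)]

/-- Changing the constant term of a quadratic polynomial of height at most `B` to a natural number
at most `B` yields a quadratic polynomial of height at most `B`. -/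
theorem X_mul_divX_add_C_mem_quadraticsUpTo {B : ℝ} {Q : ℤ[X]} (hQ : Q ∈ quadraticsUpTo B)
    {c : ℕ} (hc : (c : ℝ) ≤ B) : X * Q.divX + C (c : ℤ) ∈ quadraticsUpTo B := by
  constructor
  · rw [natDegree_add_C, natDegree_X_mul, natDegree_divX_eq_natDegree_tsub_one, hQ.1]
    intro h
    have := natDegree_divX_eq_natDegree_tsub_one (p := Q)
    rw [h, hQ.1] at this
    simp at this
  · obtain ⟨i, hi⟩ := (X * Q.divX + C (c : ℤ)).exists_eq_supNorm
    rw [hi]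
    cases i with
    | zero => simpa using hc
    | succ i =>
      rw [coeff_add, coeff_X_mul, coeff_divX, coeff_C_succ, add_zero]
      exact (Q.le_supNorm _).trans hQ.2

theorem quadraticsUpTo_nonempty {B : ℝ} (hB : 1 ≤ B) : (quadraticsUpTo B).Nonempty :=
  ⟨monomial 2 1, natDegree_monomial_eq 2 one_ne_zero, by simpa using hB⟩

/-- A set of quadratic polynomials in which each nonconstant part occurs at most `k` times has
proportion at most `k / B` up to height `B`. -/
theorem mul_ncard_le_mul_ncard_quadraticsUpTo {B : ℝ} (hB : 0 ≤ B) {k : ℕ} {s : Set ℤ[X]}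
    (hs : s ⊆ quadraticsUpTo B)
    (hk : ∀ D : ℤ[X], ∀ t : Finset ℤ[X], ↑t ⊆ s → (∀ Q ∈ t, Q.divX = D) → t.card ≤ k) :
    B * s.ncard ≤ k * (quadraticsUpTo B).ncard := by
  classical
  lift s to Finset ℤ[X] using (finite_quadraticsUpTo B).subset hs
  obtain ⟨S, hS⟩ := (finite_quadraticsUpTo B).exists_finset_coe
  rw [← hS] at hs ⊢
  rw [Set.ncard_coe_finset, Set.ncard_coe_finset]
  have h1 : s.card ≤ k * (S.image divX).card :=
    Finset.card_le_mul_card_image_of_maps_to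
      (fun Q hQ => Finset.mem_image_of_mem _ (hs hQ)) k fun D _ =>
        hk D _ (Finset.coe_subset.mpr (Finset.filter_subset _ _)) (by simp)
  -- The constant terms 0, …, ⌊B⌋ alone suffice for this lower bound on each fibre.
  have h2 : (⌊B⌋₊ + 1) * (S.image divX).card ≤ S.card := by
    refine Finset.mul_card_image_le_card S _ fun D hD => ?_
    obtain ⟨Q, hQ, rfl⟩ := Finset.mem_image.mp hD
    rw [← Finset.card_range (⌊B⌋₊ + 1)]
    refine Finset.card_le_card_of_injOn (fun c : ℕ => X * Q.divX + C (c : ℤ)) ?_ ?_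
    · intro c hc
      have hcB : (c : ℝ) ≤ B :=
        (Nat.le_floor_iff hB).mp (Nat.lt_succ_iff.mp (Finset.mem_range.mp hc))
      have hmem : X * Q.divX + C (c : ℤ) ∈ (S : Set ℤ[X]) :=
        hS ▸ X_mul_divX_add_C_mem_quadraticsUpTo (hS ▸ hQ) hcB
      refine Finset.mem_filter.mpr ⟨hmem, ?_⟩
      ext i
      rw [coeff_divX, coeff_add, coeff_X_mul, coeff_C_succ, add_zero]
    · intro c _ d _ h
      exact Nat.cast_injective (C_injective (add_left_cancel h))
  have h1' : (s.card : ℝ) ≤ k * (S.image divX).card := mod_cast h1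
  have h2' : ((⌊B⌋₊ : ℝ) + 1) * (S.image divX).card ≤ S.card := mod_cast h2
  calc B * s.card ≤ B * (k * (S.image divX).card) := by gcongr
    _ = k * (B * (S.image divX).card) := by ring
    _ ≤ k * (((⌊B⌋₊ : ℝ) + 1) * (S.image divX).card) := by
        gcongr
        exact (Nat.lt_floor_add_one B).le
    _ ≤ k * S.card := by gcongr

/-- A property holds for almost all quadratic polynomials if each nonconstant part occurs at most
`k` times among the exceptions. -/
theorem forAlmostAllQuadratics_of_card_le {P : ℤ[X] → Prop} (k : ℕ)
    (hk : ∀ D : ℤ[X], ∀ t : Finset ℤ[X], (∀ Q ∈ t, ¬ P Q) → (∀ Q ∈ t, Q.divX = D) → t.card ≤ k) :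
    ForAlmostAllQuadratics P := by
  have hlim : Filter.Tendsto (fun B : ℝ => 1 - (k : ℝ) / B) Filter.atTop (nhds 1) := by
    simpa using (Filter.Tendsto.const_div_atTop Filter.tendsto_id (k : ℝ)).const_sub 1
  refine tendsto_of_tendsto_of_tendsto_of_le_of_le' hlim tendsto_const_nhds ?_ ?_
  · filter_upwards [Filter.eventually_ge_atTop 1] with B hB
    have hfin := finite_quadraticsUpTo B
    have hpos : (0 : ℝ) < (quadraticsUpTo B).ncard := by
      exact_mod_cast (Set.ncard_pos hfin).mpr (quadraticsUpTo_nonempty hB)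
    have hB0 : 0 < B := by linarith
    have hbad := mul_ncard_le_mul_ncard_quadraticsUpTo (s := {Q ∈ quadraticsUpTo B | ¬ P Q})
      hB0.le (Set.sep_subset _ _) fun D t ht hD => hk D t (fun Q hQ => (ht hQ).2) hD
    have hsum : ({Q ∈ quadraticsUpTo B | P Q}.ncard : ℝ) + {Q ∈ quadraticsUpTo B | ¬ P Q}.ncard
        = (quadraticsUpTo B).ncard := by
      have h := Set.ncard_sdiff_add_ncard_of_subset
        (Set.sep_subset (quadraticsUpTo B) P) hfin
      rw [show quadraticsUpTo B \ {Q ∈ quadraticsUpTo B | P Q} = {Q ∈ quadraticsUpTo B | ¬ P Q} by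
        ext Q; simp +contextual] at h
      rw [add_comm]
      exact_mod_cast h
    rw [le_div_iff₀ hpos, ← sub_nonneg]
    have : ({Q ∈ quadraticsUpTo B | ¬ P Q}.ncard : ℝ) ≤ k / B * (quadraticsUpTo B).ncard := by
      rw [div_mul_eq_mul_div, le_div_iff₀ hB0]
      linarith
    linarith
  · refine Filter.Eventually.of_forall fun B => div_le_one_of_le₀ ?_ (Nat.cast_nonneg _)
    exact_mod_cast Set.ncard_le_ncard (Set.sep_subset _ _) (finite_quadraticsUpTo B)

theorem mainTheorem2 (R : ℤ[X]) (hmonic : R.Monic) (hodd : Odd R.natDegree) :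
    ForAlmostAllQuadratics fun Q => ∃ (p : ℕ) (_ : Fact p.Prime), ShareRootMod p R Q := by
  obtain ⟨n, M, hn, hM⟩ := exists_matrix_aeval_eq_zero hmonic hodd.pos
  refine forAlmostAllQuadratics_of_card_le (2 * n) fun D t ht hD =>
    card_filter_divX_eq_le hn M D (fun Q hQ => ?_) hD
  by_contra hunit
  -- This includes determinant 0, which every prime divides.
  obtain ⟨p, hp, hdvd⟩ := Nat.exists_prime_and_dvd (mt Int.isUnit_iff_natAbs_eq.mpr hunit)
  have : Fact p.Prime := ⟨hp⟩
  exact ht Q hQ ⟨p, this, shareRootMod_of_dvd_det hM p (Int.natCast_dvd.mpr hdvd)⟩
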